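/- For real \(x\) and an integer \(k\), let \(\binom{x}{k}=x(x-1)\cdots(x-k+1)/k!\) if \(k\ge 0\) and \(\binom{x}{k}=0\) if \(k<0\). Let \(\alpha>-1\), \(M\ge 0\), let \(P_n^{(\alpha,\alpha)}(x)=\sum_{k=0}^n\binom{n+2\alpha+k}{k}\binom{n+\alpha}{n-k}\left(\frac{x-1}{2}\right)^k\) be the classical Jacobi polynomials, and let, for \(n=0,1,2,\ldots\), \[P_n^{\alpha,\alpha,M,M}(x)=C_0P_n^{(\alpha,\alpha)}(x)-C_1x\frac{d}{dx}P_n^{(\alpha,\alpha)}(x)\] be the symmetric generalized Jacobi polynomials, where \[C_0=1+M\frac{2n}{\alpha+1}\binom{n+2\alpha+1}{n}+4M^2\binom{n+2\alpha+1}{n-1}^2,\] \[C_1=\frac{2M}{2\alpha+1}\binom{n+2\alpha}{n}+\frac{2M^2}{\alpha+1}\binom{n+2\alpha}{n-1}\binom{n+2\alpha+1}{n}\] (for \(\alpha=-\tfrac12\) and \(n\ge 1\) the first term of \(C_1\) is read as its limit \(2M/n\); for \(n=0\) the value of \(C_1\) is immaterial). Theorem. For every \(n=0,1,2,\ldots\)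 the polynomial \(y(x)=P_n^{\alpha,\alpha,M,M}(x)\) satisfies, for all real \(x\), \[M\sum_{i=0}^{\infty}c_i(x)y^{(i)}(x)+(1-x^2)y''(x)-2(\alpha+1)xy'(x)+n(n+2\alpha+1)y(x)=0,\] where the series converges, and the coefficients are \[c_0(x)=4(2\alpha+3)\binom{n+2\alpha+2}{n-2},\qquad c_i(x)=(2\alpha+3)(1-x^2)c_i^*(x)\quad(i=1,2,3,\ldots),\] with \(c_1^*(x)=0\) and \[c_i^*(x)=\frac{2^i}{i!}\sum_{k=0}^{i-2}\binom{\alpha+1}{i-k-2}\binom{i-2\alpha-5}{k}\left(\frac{1-x}{2}\right)^k\qquad(i=2,3,4,\ldots).\] In particular \(c_i\) does not depend on \(n\) for \(i\ge 1\). If \(\alpha\) is a nonnegative integer, then \(c_i=0\) for all \(i>2\alpha+4\), while \(c_{2\alpha+4}\) is not identically zero, so that the polynomials satisfy a linear differential equation of formal order \(2\alpha+4\) (that is, the sum may be taken over \(0\le i\le 2\alpha+4\); for \(M=0\) the true order is lower). -/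

import Mathlib

open Polynomial

noncomputable section

namespace SymJacobi

/-- The binomial coefficient `x.choose k` with real upper entry `x` and integer lower entry `k`:
`x (x - 1) ⋯ (x - k + 1) / k!` for `k ≥ 0`, and `0` for `k < 0`. -/
def binom (x : ℝ) (k : ℤ) : ℝ :=
  if 0 ≤ k then Ring.choose x k.toNat else 0

/-- The classical Jacobi polynomial `P_n^{(α,β)}`, normalised by `P_n^{(α,β)}(1) = binom (n + α) n`:
the coefficient of `((x - 1) / 2) ^ k` is `(n + α + β + 1)_k / k! * (α + k + 1)_{n - k} / (n - k)!`,
written here with binomial coefficients. -/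
def jacobi (α β : ℝ) (n : ℕ) : ℝ[X] :=
  ∑ k ∈ Finset.range (n + 1),
    C (binom (n + α + β + k) k * binom (n + α) ((n : ℤ) - k)) * (C (1 / 2) * (X - 1)) ^ k

/-- The coefficient `C₀` of the symmetric generalized Jacobi polynomial. -/
def C₀ (α M : ℝ) (n : ℕ) : ℝ :=
  1 + M * (2 * n / (α + 1)) * binom (n + 2 * α + 1) n
    + 4 * M ^ 2 * binom (n + 2 * α + 1) ((n : ℤ) - 1) ^ 2

/-- The coefficient `C₁` of the symmetric generalized Jacobi polynomial. In the first term
`2 M / (2 α + 1) * binom (n + 2 α) n` the factor `2 α + 1` cancels when `n ≥ 1`: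
`binom (n + 2 α) n / (2 α + 1) = (2 α + 2) (2 α + 3) ⋯ (2 α + n) / n!`, which is `1 / n` at
`α = - 1 / 2`, so that the term is read there as `2 M / n`.
(For `n = 0` the value of `C₁` is immaterial, as `C₁` multiplies the derivative of a constant.) -/
def C₁ (α M : ℝ) (n : ℕ) : ℝ :=
  (if 2 * α + 1 = 0 then 2 * M / n else 2 * M / (2 * α + 1) * binom (n + 2 * α) n)
    + 2 * M ^ 2 / (α + 1) * binom (n + 2 * α) ((n : ℤ) - 1) * binom (n + 2 * α + 1) n

/-- The symmetric generalized Jacobi polynomial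
`P_n^{α,α,M,M}(x) = C₀ P_n^{(α,α)}(x) - C₁ x (P_n^{(α,α)})'(x)`. -/
def genJacobi (α M : ℝ) (n : ℕ) : ℝ[X] :=
  C (C₀ α M n) * jacobi α α n - C (C₁ α M n) * X * derivative (jacobi α α n)

/-- `c_i^*(α, x)` (used for `i ≥ 1` only): `c_1^* = 0`, and for `i ≥ 2`
`c_i^*(α, x) = 2^i / i! * ∑_{k=0}^{i-2} binom (α+1) (i-k-2) * binom (i-2α-5) k * ((1-x)/2)^k`.
For `i ≤ 1` the index range is empty. -/
def cStar (α : ℝ) (i : ℕ) (x : ℝ) : ℝ :=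
  2 ^ i / (i.factorial : ℝ) *
    ∑ k ∈ Finset.range (i - 1),
      binom (α + 1) ((i : ℤ) - k - 2) * binom (i - 2 * α - 5) k * ((1 - x) / 2) ^ k

/-- The coefficient `c_i(α, x) = (2 α + 3) (1 - x²) c_i^*(α, x)` for `i ≥ 1`; it does not
depend on `n`. -/
def cPos (α : ℝ) (i : ℕ) (x : ℝ) : ℝ :=
  (2 * α + 3) * (1 - x ^ 2) * cStar α i x

/-- All coefficients: `c_0 = 4 (2 α + 3) binom (n + 2 α + 2) (n - 2)`, constant in `x`, and
`c_i = cPos α i` for `i ≥ 1`. -/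
def coeffDE (α : ℝ) (n i : ℕ) (x : ℝ) : ℝ :=
  if i = 0 then 4 * (2 * α + 3) * binom (n + 2 * α + 2) ((n : ℤ) - 2) else cPos α i x

end SymJacobi

end

open Polynomial

namespace SymJacobi

/-! Put `σ = (x - 1) / 2`, `P = P_n^{(α,α)}`, `L = ∑_{i ≥ 1} c_i D^i` and `E y = (1 - x²) y'' - 2(α
+ 1) x y' + n(n + 2α + 1) y`. For `n ≥ 1` let `B = scale α n` and `κ = n(n + 2α + 1) B / (α + 1)`.
The theorem rests on four identities: `E P = 0` (`jacobi_ode`), `E(xP') = 2P''` (`euler_ode`), `(L +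
c_0) P = 4B P''` (`sum_cPos_jacobi`), `(L + c_0)(xP') = 2κ P''`
(`sum_cPos_X_mul_derivative_jacobi`). As `C₀ = (1 + Mκ)²` and `C₁ = 2MB(1 + Mκ)`, applying `M(L +
c_0) + E` to `C₀ P - C₁ xP'` gives `P''` times `4MB(1 + Mκ)((1 + Mκ) - Mκ - 1) = 0`.

For the last two identities, Vandermonde's convolution shows that `L σ^m` is, up to a constant, the
sum of `r binom(2α+2+r, r) (2m-r-1) binom(α+2, m-r) σ^r`. Summation against the coefficients `u_m`
of `P` leads to the sums `∑ u_m binom(α, m-r)`, which have a closed form by Pfaff–Saalschütz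
(`jacobiBinomSum_eq`). Multiplied by `binom(2α+2+r, r)`, this closed form is again a simple multiple
of `u_r` (`binom_mul_jacobiBinomSum`), and the two-term recurrence for `u` finishes the comparison
of coefficients. -/

/-! ### Binomial coefficients with real upper and integer lower entry -/

theorem binom_natCast (x : ℝ) (k : ℕ) : binom x k = Ring.choose x k := by
  simp [binom]

theorem binom_of_neg (x : ℝ) {k : ℤ} (hk : k < 0) : binom x k = 0 := by
  simp [binom, not_le.mpr hk]

theorem binom_zero (x : ℝ) : binom x 0 = 1 := by
  simp [binom]

theorem succ_mul_binom_succ (x : ℝ) (k : ℤ) :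
    ((k : ℝ) + 1) * binom x (k + 1) = (x - k) * binom x k := by
  rcases lt_trichotomy k (-1) with h | h | h
  · rw [binom_of_neg x (by omega), binom_of_neg x (by omega)]; simp
  · subst h; simp [binom_of_neg]
  · lift k to ℕ using by omega
    have h1 := Ring.choose_smul_choose x (Nat.le_succ k)
    rw [← Nat.cast_succ, binom_natCast, binom_natCast]
    simp only [Nat.succ_eq_add_one, Nat.choose_succ_self_right, Nat.add_sub_cancel_left,
      Ring.choose_one_right, nsmul_eq_mul] at h1
    push_cast at h1 ⊢
    rw [h1]; ring

theorem binom_add_one (x : ℝ) (k : ℤ) :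
    binom (x + 1) (k + 1) = binom x k + binom x (k + 1) := by
  rcases lt_trichotomy k (-1) with h | h | h
  · rw [binom_of_neg _ (by omega), binom_of_neg _ (by omega), binom_of_neg _ (by omega)]; simp
  · subst h; simp [binom_of_neg, binom_zero]
  · lift k to ℕ using by omega
    rw [← Nat.cast_succ, binom_natCast, binom_natCast, binom_natCast]
    exact Ring.choose_succ_succ x k

theorem succ_mul_binom_add_one (x : ℝ) (k : ℤ) :
    ((k : ℝ) + 1) * binom (x + 1) (k + 1) = (x + 1) * binom x k := by
  rw [binom_add_one]
  linear_combination succ_mul_binom_succ x k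

theorem sub_mul_binom_add_one (x : ℝ) (k : ℤ) :
    (x + 1 - k) * binom (x + 1) k = (x + 1) * binom x k := by
  obtain ⟨j, rfl⟩ : ∃ j, k = j + 1 := ⟨k - 1, by ring⟩
  rw [binom_add_one]
  push_cast
  linear_combination -succ_mul_binom_succ x j

/-! ### Jacobi coefficients and the Pfaff–Saalschütz sum -/

/-- The coefficient of `((x - 1) / 2) ^ m` in `P_n^{(α,α)}`. -/
noncomputable def jacobiCoeff (α : ℝ) (n m : ℕ) : ℝ :=
  binom (n + 2 * α + m) m * binom (n + α) ((n : ℤ) - m)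

theorem jacobiCoeff_eq_zero (α : ℝ) {n m : ℕ} (h : n < m) : jacobiCoeff α n m = 0 := by
  rw [jacobiCoeff, binom_of_neg (n + α) (by omega), mul_zero]

theorem jacobiCoeff_succ (α : ℝ) (n m : ℕ) :
    ((m : ℝ) + 1) * (m + 1 + α) * jacobiCoeff α n (m + 1)
      = (n - m) * (n + 2 * α + 1 + m) * jacobiCoeff α n m := by
  have h1 := succ_mul_binom_add_one (n + 2 * α + m) m
  have h2 := succ_mul_binom_succ (n + α) ((n : ℤ) - m - 1)
  have e1 : (n : ℝ) + 2 * α + (m + 1 : ℕ) = n + 2 * α + m + 1 := by push_cast; ring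
  have e2 : (n : ℤ) - (m + 1 : ℕ) = (n : ℤ) - m - 1 := by push_cast; ring
  have e3 : ((m + 1 : ℕ) : ℤ) = (m : ℤ) + 1 := by push_cast; ring
  unfold jacobiCoeff
  rw [e1, e2, e3]
  rw [sub_add_cancel] at h2
  push_cast at h1 h2
  linear_combination (m + 1 + α) * binom (n + α) (n - m - 1) * h1
    - (n + 2 * α + m + 1) * binom (n + 2 * α + m) m * h2

/-- The sum over `m` of the coefficients of `P_n^{(α,α)}` weighted by `binom α (m - r)`. -/
noncomputable def jacobiBinomSum (α : ℝ) (n r : ℕ) : ℝ :=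
  ∑ m ∈ Finset.range (n + 1), jacobiCoeff α n m * binom α ((m : ℤ) - r)

/-- Creative telescoping: with `F(m) = m(m + α) u_m binom(α, m-r-1)`, the right side minus the left
is `∑ (F(m+1) - F(m))`, and `F` vanishes at `0` and at `n + 1`. -/
theorem jacobiBinomSum_succ (α : ℝ) (n r : ℕ) :
    (2 * α + r + 1) * (r + 1 + α) * jacobiBinomSum α n (r + 1)
      = (n + 2 * α + 1 + r) * (n - r) * jacobiBinomSum α n r := by
  have tele := Finset.sum_range_sub
    (fun m : ℕ => (m : ℝ) * (m + α) * jacobiCoeff α n m * binom α ((m : ℤ) - r - 1)) (n + 1)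
  rw [jacobiCoeff_eq_zero α (Nat.lt_succ_self n)] at tele
  simp only [Nat.cast_zero, zero_mul, mul_zero, sub_zero] at tele
  rw [← sub_eq_zero, ← neg_eq_zero, ← tele, jacobiBinomSum, jacobiBinomSum, Finset.mul_sum,
    Finset.mul_sum, ← Finset.sum_sub_distrib, ← Finset.sum_neg_distrib]
  refine Finset.sum_congr rfl fun m _ => ?_
  have h1 := succ_mul_binom_succ α ((m : ℤ) - r - 1)
  have h2 := jacobiCoeff_succ α n m
  have e1 : (m : ℤ) - (r + 1 : ℕ) = (m : ℤ) - r - 1 := by push_cast; ring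
  have e2 : ((m + 1 : ℕ) : ℤ) - r - 1 = (m : ℤ) - r := by push_cast; ring
  rw [sub_add_cancel] at h1
  rw [e1, e2]
  push_cast at h1 ⊢
  linear_combination (m + r + 2 * α + 1) * jacobiCoeff α n m * h1
    - binom α (m - r) * h2

theorem jacobiBinomSum_eq_zero (α : ℝ) {n r : ℕ} (h : n < r) : jacobiBinomSum α n r = 0 := by
  refine Finset.sum_eq_zero fun m hm => ?_
  have := Finset.mem_range.mp hm
  rw [binom_of_neg α (by omega), mul_zero]

/-- A form of the Pfaff–Saalschütz identity. -/
theorem jacobiBinomSum_eq {α : ℝ} (hα : -1 < α) (n r : ℕ) :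
    jacobiBinomSum α n r = binom (n + 2 * α + r) n * binom (n + α) ((n : ℤ) - r) := by
  -- Descending induction on `r`: for `r = n` only the term `m = n` survives. The recurrence is then
  -- solved for the value at `r < n`, where its factor `(n + 2α + 1 + r)(n - r)` is positive; the
  -- factor on the other side can vanish, as at `α = -1/2`, `r = 0`.
  have key : ∀ j r : ℕ, n < r + j →
      jacobiBinomSum α n r = binom (n + 2 * α + r) n * binom (n + α) ((n : ℤ) - r) := by
    intro j
    induction j with
    | zero =>
      intro r hr
      rw [jacobiBinomSum_eq_zero α (by omega), binom_of_neg (n + α) (by omega), mul_zero]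
    | succ j ih =>
      intro r hr
      rcases lt_trichotomy n r with h | h | h
      · rw [jacobiBinomSum_eq_zero α h, binom_of_neg (n + α) (by omega), mul_zero]
      · subst h
        rw [jacobiBinomSum, Finset.sum_range_succ, Finset.sum_eq_zero, jacobiCoeff, sub_self,
          binom_zero, binom_zero, zero_add, mul_one]
        intro m hm
        have := Finset.mem_range.mp hm
        rw [binom_of_neg α (by omega), mul_zero]
      · have h1 := jacobiBinomSum_succ α n r
        rw [ih (r + 1) (by omega)] at h1
        have h2 := sub_mul_binom_add_one (n + 2 * α + r) n
        have h3 := succ_mul_binom_succ (n + α) ((n : ℤ) - r - 1)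
        have e1 : (n : ℝ) + 2 * α + (r + 1 : ℕ) = n + 2 * α + r + 1 := by push_cast; ring
        have e2 : (n : ℤ) - (r + 1 : ℕ) = (n : ℤ) - r - 1 := by push_cast; ring
        rw [e1, e2] at h1
        rw [sub_add_cancel] at h3
        push_cast at h2 h3
        have hn : (r : ℝ) + 1 ≤ n := by exact_mod_cast h
        have hr0 : (0 : ℝ) ≤ r := r.cast_nonneg
        have hne : (n + 2 * α + 1 + r) * ((n : ℝ) - r) ≠ 0 :=
          mul_ne_zero (by linarith) (by linarith)
        refine mul_left_cancel₀ hne ?_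
        rw [← h1]
        linear_combination (r + 1 + α) * binom (n + α) (n - r - 1) * h2
          - (n + 2 * α + r + 1) * binom (n + 2 * α + r) n * h3
  exact key (n + 1) r (by omega)

/-! ### The differential operator on powers of `(x - 1) / 2` -/

theorem eval_iterate_derivative_half_sub_one_pow (m i : ℕ) (x : ℝ) :
    (derivative^[i] ((C (1 / 2) * (X - 1)) ^ m : ℝ[X])).eval x
      = m.descFactorial i / 2 ^ i * ((x - 1) / 2) ^ (m - i) := by
  have h : ((C (1 / 2) * (X - 1)) ^ m : ℝ[X]) = C ((1 / 2) ^ m) * (X - C 1) ^ m := by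
    rw [mul_pow, C_pow, C_1]
  rw [h, iterate_derivative_C_mul, iterate_derivative_X_sub_pow]
  rcases le_or_gt i m with hi | hi
  · obtain ⟨j, rfl⟩ := Nat.exists_eq_add_of_le hi
    simp only [eval_mul, eval_C, eval_pow, eval_sub, eval_X, nsmul_eq_mul,
      Nat.add_sub_cancel_left, div_pow, one_pow, pow_add, eval_natCast]
    field_simp
  · simp [Nat.descFactorial_of_lt hi]

/-- Chu–Vandermonde for the upper entries `m` and `2α + 4 - m + r`, after negating the upper entry
of the second binomial. -/
theorem sum_choose_mul_binom (α : ℝ) {m r : ℕ} (hr : r ≤ m) :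
    ∑ k ∈ Finset.range (r + 1),
        (m.choose (m - r + k) : ℝ) * ((-1) ^ k * binom ((m - r + k : ℕ) - 2 * α - 5) k)
      = binom (2 * α + 4 + r) r := by
  have h := Ring.add_choose_eq r (Commute.all (2 * α + 4 - m + r) (m : ℝ))
  rw [show 2 * α + 4 - m + r + m = 2 * α + 4 + r by ring, ← binom_natCast,
    Finset.Nat.sum_antidiagonal_eq_sum_range_succ_mk] at h
  rw [h]
  refine Finset.sum_congr rfl fun k hk => ?_
  have hk' : k ≤ r := Nat.lt_succ_iff.mp (Finset.mem_range.mp hk)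
  have e : 2 * α + 4 - m + r = -((m : ℝ) - r - 2 * α - 4) := by ring
  dsimp only
  rw [Ring.choose_natCast, ← Nat.choose_symm (show r - k ≤ m by omega),
    show m - (r - k) = m - r + k by omega, e, Ring.choose_neg, binom_natCast, mul_comm]
  congr 1
  push_cast [Nat.cast_sub hr]
  rw [show (m : ℝ) - r - 2 * α - 4 + k - 1 = m - r + k - 2 * α - 5 by ring]
  rcases Nat.even_or_odd k with h | h
  · rw [h.neg_one_pow, Int.negOnePow_even _ (by exact_mod_cast h)]; simp
  · rw [h.neg_one_pow, Int.negOnePow_odd _ (by exact_mod_cast h)]; simp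

theorem cStar_eq (α : ℝ) (i : ℕ) (x : ℝ) :
    cStar α i x = 2 ^ i / (i.factorial : ℝ) *
      ∑ k ∈ Finset.range (i + 1),
        binom (α + 1) ((i : ℤ) - k - 2) * ((-1) ^ k * binom (i - 2 * α - 5) k)
          * ((x - 1) / 2) ^ k := by
  rw [cStar]
  congr 1
  -- The added terms `k ≥ i - 1` have a negative lower entry `i - k - 2`.
  rw [← Finset.sum_subset (Finset.range_mono (show i - 1 ≤ i + 1 by omega))]
  · refine Finset.sum_congr rfl fun k _ => ?_
    rw [show (1 - x) / 2 = (-1) * ((x - 1) / 2) by ring, mul_pow]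
    ring
  · intro k _ hk
    rw [Finset.mem_range] at hk
    rw [binom_of_neg (α + 1) (by omega), zero_mul, zero_mul]

/-- The operator `∑ i, c_i^* D^i` applied to `((x - 1) / 2) ^ m`. -/
theorem sum_cStar_mul_derivative_pow (α x : ℝ) (m N : ℕ) (hN : m < N) :
    ∑ i ∈ Finset.range N,
        cStar α i x * (derivative^[i] ((C (1 / 2) * (X - 1)) ^ m : ℝ[X])).eval x
      = ∑ r ∈ Finset.range (m + 1),
        binom (α + 1) ((m : ℤ) - r - 2) * binom (2 * α + 4 + r) r * ((x - 1) / 2) ^ r := by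
  set σ := (x - 1) / 2 with hσ
  rw [← Finset.sum_subset (Finset.range_mono (show m + 1 ≤ N by omega))]
  swap
  · intro i _ hi
    rw [Finset.mem_range] at hi
    rw [eval_iterate_derivative_half_sub_one_pow, Nat.descFactorial_of_lt (by omega)]
    simp
  have h1 : ∀ i ∈ Finset.range (m + 1),
      cStar α i x * (derivative^[i] ((C (1 / 2) * (X - 1)) ^ m : ℝ[X])).eval x
        = ∑ k ∈ Finset.range (i + 1),
          binom (α + 1) ((i : ℤ) - k - 2) *
            ((m.choose i : ℝ) * ((-1) ^ k * binom (i - 2 * α - 5) k)) * σ ^ (m - i + k) := by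
    intro i _
    rw [eval_iterate_derivative_half_sub_one_pow, cStar_eq, Finset.mul_sum, Finset.sum_mul]
    refine Finset.sum_congr rfl fun k _ => ?_
    rw [Nat.descFactorial_eq_factorial_mul_choose, pow_add, ← hσ]
    have := Nat.factorial_ne_zero i
    push_cast
    field_simp
  have h2 : ∀ r ∈ Finset.range (m + 1),
      binom (α + 1) ((m : ℤ) - r - 2) * binom (2 * α + 4 + r) r * σ ^ r
        = ∑ k ∈ Finset.range (r + 1), binom (α + 1) ((m : ℤ) - r - 2) *
          ((m.choose (m - r + k) : ℝ) * ((-1) ^ k * binom ((m - r + k : ℕ) - 2 * α - 5) k))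
            * σ ^ r := by
    intro r hr
    rw [← sum_choose_mul_binom α (Nat.lt_succ_iff.mp (Finset.mem_range.mp hr)), Finset.mul_sum,
      Finset.sum_mul]
  rw [Finset.sum_congr rfl h1, Finset.sum_congr rfl h2, Finset.sum_sigma', Finset.sum_sigma']
  -- The exponent of `σ` is `r = m - i + k`; for fixed `k` the map `i ↦ m - i + k` is an involution.
  refine Finset.sum_bij' (fun p _ => ⟨m - p.1 + p.2, p.2⟩) (fun p _ => ⟨m - p.1 + p.2, p.2⟩)
    ?_ ?_ ?_ ?_ ?_
  · rintro ⟨i, k⟩ h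
    simp only [Finset.mem_sigma, Finset.mem_range] at h ⊢
    omega
  · rintro ⟨i, k⟩ h
    simp only [Finset.mem_sigma, Finset.mem_range] at h ⊢
    omega
  · rintro ⟨i, k⟩ h
    simp only [Finset.mem_sigma, Finset.mem_range] at h
    simp only [Sigma.mk.injEq, heq_eq_eq, and_true]
    omega
  · rintro ⟨i, k⟩ h
    simp only [Finset.mem_sigma, Finset.mem_range] at h
    simp only [Sigma.mk.injEq, heq_eq_eq, and_true]
    omega
  · rintro ⟨i, k⟩ h
    simp only [Finset.mem_sigma, Finset.mem_range] at h
    dsimp only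
    rw [show m - (m - i + k) + k = i by omega,
      show (m : ℤ) - (m - i + k : ℕ) - 2 = (i : ℤ) - k - 2 by omega]

/-- Carries the factor `1 - x² = -4σ(1 + σ)` into the coefficients. The subtracted term is the one
of degree `N + 1`, which the left side omits. -/
theorem sum_shift_mul_pow (q : ℕ → ℝ) (σ : ℝ) (N : ℕ) :
    ∑ r ∈ Finset.range (N + 1),
        ((if 1 ≤ r then q (r - 1) else 0) + (if 2 ≤ r then q (r - 2) else 0)) * σ ^ r
      = σ * (1 + σ) * ∑ r ∈ Finset.range N, q r * σ ^ r
        - (if 1 ≤ N then q (N - 1) * σ ^ (N + 1) else 0) := by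
  induction N with
  | zero => simp
  | succ N ih =>
    rw [Finset.sum_range_succ, ih, Finset.sum_range_succ _ N]
    rcases N with _ | N
    · simp; ring
    · simp; ring

/-- For `r = j + 2` all binomials with upper entry near `2α + 4 + j` are multiples of `binom(2α+4+j,
j)`, and Pascal's rule merges the other factors into `binom(α+2, m-r)`. For `r ≤ 1` some shifted
terms are absent. -/
theorem binom_weight_eq (α : ℝ) (m r : ℕ) :
    (2 * α + 3) * (α + 2) *
      ((if 1 ≤ r then binom (α + 1) ((m : ℤ) - (r - 1 : ℕ) - 2)
          * binom (2 * α + 4 + (r - 1 : ℕ)) (r - 1 : ℕ) else 0)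
        + (if 2 ≤ r then binom (α + 1) ((m : ℤ) - (r - 2 : ℕ) - 2)
          * binom (2 * α + 4 + (r - 2 : ℕ)) (r - 2 : ℕ) else 0))
      = r * binom (2 * α + 2 + r) r * (2 * m - r - 1) * binom (α + 2) ((m : ℤ) - r) / 2 := by
  rcases r with _ | _ | j
  · simp
  · have h1 := succ_mul_binom_add_one (α + 1) ((m : ℤ) - 2)
    have h2 := succ_mul_binom_succ (2 * α + 3) 0
    rw [show (m : ℤ) - 2 + 1 = m - 1 by ring, show α + 1 + 1 = α + 2 by ring] at h1
    rw [binom_zero] at h2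
    push_cast at h1 h2
    simp only [zero_add, Nat.cast_one, le_refl, if_true, Nat.sub_self, Nat.cast_zero, sub_zero,
      add_zero, binom_zero, show ¬ (2 ≤ 1) by omega, if_false, mul_one, one_mul]
    rw [show 2 * α + 2 + 1 = 2 * α + 3 by ring]
    simp only [zero_add, one_mul, sub_zero, mul_one] at h2
    rw [h2]
    linear_combination -(2 * α + 3) * h1
  · have hj : (j : ℝ) + 1 ≠ 0 := by positivity
    have h1 := succ_mul_binom_add_one (2 * α + 4 + j) j
    have h2 := succ_mul_binom_succ (2 * α + 4 + j) j
    have h3 := succ_mul_binom_succ (2 * α + 4 + j) (j + 1)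
    have h4 := succ_mul_binom_add_one (α + 1) ((m : ℤ) - j - 3)
    have h5 := binom_add_one (α + 1) ((m : ℤ) - j - 3)
    rw [show (m : ℤ) - j - 3 + 1 = m - j - 2 by ring, show α + 1 + 1 = α + 2 by ring] at h4 h5
    rw [show (j : ℤ) + 1 + 1 = j + 2 by ring] at h3
    simp only [show 1 ≤ j + 1 + 1 by omega, show 2 ≤ j + 1 + 1 by omega, if_true,
      show j + 1 + 1 - 1 = j + 1 by omega, show j + 1 + 1 - 2 = j by omega]
    push_cast at h1 h2 h3 h4 ⊢
    rw [show (m : ℤ) - (j + 1) - 2 = m - j - 3 by ring,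
      show (m : ℤ) - (j + 1 + 1) = m - j - 2 by ring,
      show (j : ℤ) + 1 + 1 = j + 2 by ring,
      show 2 * α + 4 + ((j : ℝ) + 1) = 2 * α + 4 + j + 1 by ring,
      show 2 * α + 2 + ((j : ℝ) + 1 + 1) = 2 * α + 4 + j by ring]
    refine mul_left_cancel₀ hj ?_
    generalize binom (2 * α + 4 + j + 1) (j + 1) = a1 at *
    generalize binom (2 * α + 4 + j) (j + 1) = a2 at *
    generalize binom (2 * α + 4 + j) (j + 2) = a3 at *
    generalize binom (2 * α + 4 + j) j = a0 at *
    generalize binom (α + 1) (m - j - 3) = b1 at *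
    generalize binom (α + 1) (m - j - 2) = b0 at *
    generalize binom (α + 2) (m - j - 2) = b2 at *
    linear_combination (2 * α + 3) * (α + 2) * b1 * h1
      - (j + 1) * (2 * m - j - 3) * b2 / 2 * h3 - (2 * α + 3) * (2 * m - j - 3) * b2 / 2 * h2
      - (2 * α + 3) * (α + 2) * a0 * 2 * h4 - (2 * α + 3) * (α + 2) * a0 * (j + 1) * h5

/-- The operator `∑ i ≥ 1, c_i D^i` applied to `((x - 1) / 2) ^ m`. -/
theorem sum_cPos_mul_derivative_pow {α : ℝ} (hα : -1 < α) (x : ℝ) (m N R : ℕ) (hN : m < N)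
    (hR : m < R) :
    ∑ i ∈ Finset.range N,
        cPos α i x * (derivative^[i] ((C (1 / 2) * (X - 1)) ^ m : ℝ[X])).eval x
      = -(2 / (α + 2)) * ∑ r ∈ Finset.range (R + 1),
        r * binom (2 * α + 2 + r) r * ((2 * m - r - 1) * binom (α + 2) ((m : ℤ) - r))
          * ((x - 1) / 2) ^ r := by
  have h2 : α + 2 ≠ 0 := by linarith
  have h := sum_shift_mul_pow
    (fun r => binom (α + 1) ((m : ℤ) - r - 2) * binom (2 * α + 4 + r) r) ((x - 1) / 2) R
  rw [binom_of_neg (α + 1) (show (m : ℤ) - (R - 1 : ℕ) - 2 < 0 by omega)] at h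
  simp only [zero_mul, ite_self, sub_zero] at h
  have h0 : ∑ r ∈ Finset.range R,
        binom (α + 1) ((m : ℤ) - r - 2) * binom (2 * α + 4 + r) r * ((x - 1) / 2) ^ r
      = ∑ r ∈ Finset.range (m + 1),
        binom (α + 1) ((m : ℤ) - r - 2) * binom (2 * α + 4 + r) r * ((x - 1) / 2) ^ r := by
    refine (Finset.sum_subset (Finset.range_mono (by omega)) fun r _ hr => ?_).symm
    rw [Finset.mem_range] at hr
    rw [binom_of_neg (α + 1) (by omega), zero_mul, zero_mul]
  rw [h0, ← sum_cStar_mul_derivative_pow α x m N hN] at h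
  simp only [cPos, mul_assoc]
  simp only [mul_assoc] at h
  rw [← Finset.mul_sum, ← Finset.mul_sum,
    show (2 * α + 3) * ((1 - x ^ 2) * ∑ i ∈ Finset.range N, (cStar α i x *
      (derivative^[i] ((C (1 / 2) * (X - 1)) ^ m : ℝ[X])).eval x))
      = (2 * α + 3) * (-4) * ((x - 1) / 2 * ((1 + (x - 1) / 2) * ∑ i ∈ Finset.range N,
        (cStar α i x * (derivative^[i] ((C (1 / 2) * (X - 1)) ^ m : ℝ[X])).eval x))) by ring,
    ← h, Finset.mul_sum, Finset.mul_sum]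
  refine Finset.sum_congr rfl fun r _ => ?_
  have := binom_weight_eq α m r
  generalize binom (2 * α + 2 + r) r = w at *
  generalize binom (α + 2) (m - r) = b at *
  field_simp
  linear_combination -4 * ((x - 1) / 2) ^ r * this

/-! ### Weighted sums over the coefficients of `P` and `xP'` -/

theorem binom_add_two (x : ℝ) (l : ℤ) :
    binom (x + 2) l = binom x l + 2 * binom x (l - 1) + binom x (l - 2) := by
  have h1 := binom_add_one (x + 1) (l - 1)
  have h2 := binom_add_one x (l - 1)
  have h3 := binom_add_one x (l - 2)
  rw [sub_add_cancel] at h1 h2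
  rw [show l - 2 + 1 = l - 1 by ring] at h3
  rw [show x + 1 + 1 = x + 2 by ring] at h1
  linarith

theorem mul_binom_add_two (x : ℝ) (l : ℤ) :
    (l : ℝ) * binom (x + 2) l = (x + 2) * (binom x (l - 1) + binom x (l - 2)) := by
  have h1 := succ_mul_binom_add_one (x + 1) (l - 1)
  have h3 := binom_add_one x (l - 2)
  rw [sub_add_cancel] at h1
  rw [show l - 2 + 1 = l - 1 by ring] at h3
  rw [show x + 1 + 1 = x + 2 by ring] at h1
  push_cast at h1
  linear_combination h1 + (x + 2) * h3

theorem mul_sub_one_mul_binom_add_two (x : ℝ) (l : ℤ) :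
    (l : ℝ) * (l - 1) * binom (x + 2) l = (x + 2) * (x + 1) * binom x (l - 2) := by
  have h1 := succ_mul_binom_add_one (x + 1) (l - 1)
  have h3 := succ_mul_binom_add_one x (l - 2)
  rw [sub_add_cancel] at h1
  rw [show l - 2 + 1 = l - 1 by ring] at h3
  rw [show x + 1 + 1 = x + 2 by ring] at h1
  push_cast at h1 h3
  linear_combination ((l : ℝ) - 1) * h1 + (x + 2) * h3

/-- With `l = m - r` the weight is `(2l + (r - 1)) binom(α+2, l)`, and both parts expand in
`binom(α, l - j)`, `j ≤ 2`. -/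
theorem sum_jacobiCoeff_mul_weight (α : ℝ) (n r : ℕ) :
    ∑ m ∈ Finset.range (n + 1),
        jacobiCoeff α n m * ((2 * m - r - 1) * binom (α + 2) ((m : ℤ) - r))
      = (r - 1) * jacobiBinomSum α n r + 2 * (r + α + 1) * jacobiBinomSum α n (r + 1)
        + (r + 2 * α + 3) * jacobiBinomSum α n (r + 2) := by
  simp only [jacobiBinomSum, Finset.mul_sum, ← Finset.sum_add_distrib]
  refine Finset.sum_congr rfl fun m _ => ?_
  have h1 := binom_add_two α ((m : ℤ) - r)
  have h2 := mul_binom_add_two α ((m : ℤ) - r)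
  push_cast at h2 ⊢
  rw [show (m : ℤ) - (r + 1) = m - r - 1 by ring, show (m : ℤ) - (r + 2) = m - r - 2 by ring]
  linear_combination (r - 1) * jacobiCoeff α n m * h1 + 2 * jacobiCoeff α n m * h2

/-- The coefficient of `((x - 1) / 2) ^ m` in `x (P_n^{(α,α)})'(x)`. -/
noncomputable def eulerCoeff (α : ℝ) (n m : ℕ) : ℝ :=
  ((m + 1) * jacobiCoeff α n (m + 1) + 2 * m * jacobiCoeff α n m) / 2

/-- After the `u_{m+1}` part is shifted, the polynomial factors are quadratic in `l = m - r` or `l =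
m - r - 1`; they are expanded in `l(l - 1)`, `l`, `1`, each of which absorbs into `binom(α+2, l)`.
-/
theorem sum_eulerCoeff_mul_weight (α : ℝ) (n r : ℕ) :
    2 * ∑ m ∈ Finset.range (n + 1),
        eulerCoeff α n m * ((2 * m - r - 1) * binom (α + 2) ((m : ℤ) - r))
      = 2 * r * (r - 1) * jacobiBinomSum α n r
        + (2 * (3 * r + 1) * (α + 2) + 4 * r * (r - 1) + r ^ 2 - 1) * jacobiBinomSum α n (r + 1)
        + (4 * (α + 1) * (α + 2) + 2 * (3 * r + 1) * (α + 2) + 2 * r * (r - 1)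
            + (3 * r + 3) * (α + 2) + 2 * (r ^ 2 - 1)) * jacobiBinomSum α n (r + 2)
        + (r + 2 * α + 3) * (r + α + 3) * jacobiBinomSum α n (r + 3) := by
  have shift : ∑ m ∈ Finset.range (n + 1), ((m : ℝ) + 1) * jacobiCoeff α n (m + 1)
        * ((2 * m - r - 1) * binom (α + 2) ((m : ℤ) - r))
      = ∑ m ∈ Finset.range (n + 1), (m : ℝ) * jacobiCoeff α n m
        * ((2 * m - r - 3) * binom (α + 2) ((m : ℤ) - r - 1)) := by
    have h1 := Finset.sum_range_succ' (fun m : ℕ => (m : ℝ) * jacobiCoeff α n m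
        * ((2 * m - r - 3) * binom (α + 2) ((m : ℤ) - r - 1))) (n + 1)
    rw [Finset.sum_range_succ, jacobiCoeff_eq_zero α (Nat.lt_succ_self n)] at h1
    simp only [Nat.cast_zero, zero_mul, mul_zero, add_zero] at h1
    rw [h1]
    refine Finset.sum_congr rfl fun m _ => ?_
    push_cast
    rw [show (m : ℤ) + 1 - r - 1 = m - r by ring]
    ring
  have h : 2 * ∑ m ∈ Finset.range (n + 1),
        eulerCoeff α n m * ((2 * m - r - 1) * binom (α + 2) ((m : ℤ) - r))
      = ∑ m ∈ Finset.range (n + 1), ((m : ℝ) + 1) * jacobiCoeff α n (m + 1)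
        * ((2 * m - r - 1) * binom (α + 2) ((m : ℤ) - r))
      + ∑ m ∈ Finset.range (n + 1), 2 * (m : ℝ) * jacobiCoeff α n m
        * ((2 * m - r - 1) * binom (α + 2) ((m : ℤ) - r)) := by
    rw [Finset.mul_sum, ← Finset.sum_add_distrib]
    refine Finset.sum_congr rfl fun m _ => ?_
    rw [eulerCoeff]
    ring
  rw [h, shift]
  simp only [jacobiBinomSum, Finset.mul_sum, ← Finset.sum_add_distrib]
  refine Finset.sum_congr rfl fun m _ => ?_
  have h1 := binom_add_two α ((m : ℤ) - r)
  have h2 := mul_binom_add_two α ((m : ℤ) - r)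
  have h3 := mul_sub_one_mul_binom_add_two α ((m : ℤ) - r)
  have k1 := binom_add_two α ((m : ℤ) - r - 1)
  have k2 := mul_binom_add_two α ((m : ℤ) - r - 1)
  have k3 := mul_sub_one_mul_binom_add_two α ((m : ℤ) - r - 1)
  rw [show (m : ℤ) - r - 1 - 1 = m - r - 2 by ring,
    show (m : ℤ) - r - 1 - 2 = m - r - 3 by ring] at k1 k2
  rw [show (m : ℤ) - r - 1 - 2 = m - r - 3 by ring] at k3
  push_cast at h2 h3 k2 k3 ⊢
  rw [show (m : ℤ) - (r + 1) = m - r - 1 by ring, show (m : ℤ) - (r + 2) = m - r - 2 by ring,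
    show (m : ℤ) - (r + 3) = m - r - 3 by ring]
  generalize jacobiCoeff α n m = u at *
  linear_combination u * (4 * h3 + 2 * (3 * r + 1) * h2 + 2 * r * (r - 1) * h1
    + 2 * k3 + (3 * r + 3) * k2 + (r ^ 2 - 1) * k1)

/-! ### Closed forms in terms of the normalising factor -/

/-- The normalising factor `(2 α + 2) (2 α + 3) ⋯ (2 α + n) / n!`. -/
noncomputable def scale (α : ℝ) (n : ℕ) : ℝ :=
  binom (n + 2 * α) ((n : ℤ) - 1) / n

theorem natCast_mul_scale (α : ℝ) {n : ℕ} (hn : n ≠ 0) :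
    n * scale α n = binom (n + 2 * α) ((n : ℤ) - 1) := by
  have : (n : ℝ) ≠ 0 := by exact_mod_cast hn
  rw [scale]; field_simp

/-- Isolates the factor `2α + 1` that cancels in `C₁`, so that `α = -1/2` needs no separate
treatment later. -/
theorem binom_eq_scale (α : ℝ) {n : ℕ} (hn : n ≠ 0) :
    binom (n + 2 * α) n = (2 * α + 1) * scale α n := by
  have h0 : (n : ℝ) ≠ 0 := by exact_mod_cast hn
  have h1 := natCast_mul_scale α hn
  have h2 := succ_mul_binom_succ (n + 2 * α) ((n : ℤ) - 1)
  rw [sub_add_cancel] at h2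
  push_cast at h2
  refine mul_left_cancel₀ h0 ?_
  linear_combination h2 - (2 * α + 1) * h1

theorem binom_add_one_eq_scale (α : ℝ) {n : ℕ} (hn : n ≠ 0) :
    binom (n + 2 * α + 1) n = (n + 2 * α + 1) * scale α n := by
  have h0 : (n : ℝ) ≠ 0 := by exact_mod_cast hn
  have h1 := natCast_mul_scale α hn
  have h2 := succ_mul_binom_add_one (n + 2 * α) ((n : ℤ) - 1)
  rw [sub_add_cancel] at h2
  push_cast at h2
  refine mul_left_cancel₀ h0 ?_
  linear_combination h2 - (n + 2 * α + 1) * h1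

theorem binom_add_one_pred_eq_scale (α : ℝ) {n : ℕ} (hn : n ≠ 0) :
    (2 * α + 2) * binom (n + 2 * α + 1) ((n : ℤ) - 1)
      = n * (n + 2 * α + 1) * scale α n := by
  have h1 := natCast_mul_scale α hn
  have h2 := sub_mul_binom_add_one (n + 2 * α) ((n : ℤ) - 1)
  push_cast at h2
  linear_combination h2 - (n + 2 * α + 1) * h1

theorem binom_add_two_eq_scale (α : ℝ) {n : ℕ} (hn : n ≠ 0) :
    (α + 1) * (α + 2) * (4 * (2 * α + 3) * binom (n + 2 * α + 2) ((n : ℤ) - 2))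
      = n * (n - 1) * (n + 2 * α + 1) * (n + 2 * α + 2) * scale α n := by
  have h1 := binom_add_one_pred_eq_scale α hn
  have h2 := sub_mul_binom_add_one (n + 2 * α + 1) ((n : ℤ) - 1)
  have h3 := succ_mul_binom_succ (n + 2 * α + 2) ((n : ℤ) - 2)
  rw [show (n : ℤ) - 2 + 1 = n - 1 by ring] at h3
  rw [show (n : ℝ) + 2 * α + 1 + 1 = n + 2 * α + 2 by ring] at h2
  push_cast at h2 h3
  linear_combination -(α + 1) * (2 * (2 * α + 3)) * h3 + 2 * (α + 1) * (n - 1) * h2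
    + (n - 1) * (n + 2 * α + 2) * h1

theorem binom_mul_binom_pred {α : ℝ} (hα : -1 < α) {n : ℕ} (hn : n ≠ 0) (r : ℕ) :
    2 * (α + 1) * binom (2 * α + 2 + r) r * binom (n + 2 * α + r) ((n : ℤ) - 1)
      = n * (r + 2 * α + 2) * scale α n * binom (n + 2 * α + r) r := by
  induction r with
  | zero =>
    have h1 := natCast_mul_scale α hn
    simp only [Nat.cast_zero, add_zero, binom_zero]
    linear_combination -2 * (α + 1) * h1
  | succ r ih =>
    have h1 := succ_mul_binom_add_one (2 * α + 2 + r) r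
    have h2 := sub_mul_binom_add_one (n + 2 * α + r) ((n : ℤ) - 1)
    have h3 := succ_mul_binom_add_one (n + 2 * α + r) r
    push_cast at h1 h2 h3 ⊢
    rw [show 2 * α + 2 + ((r : ℝ) + 1) = 2 * α + 2 + r + 1 by ring,
      show (n : ℝ) + 2 * α + (r + 1) = n + 2 * α + r + 1 by ring]
    have hr : (0 : ℝ) ≤ r := r.cast_nonneg
    have hne : ((r : ℝ) + 1) * (r + 2 * α + 2) ≠ 0 :=
      mul_ne_zero (by linarith) (by linarith)
    refine mul_left_cancel₀ hne ?_
    generalize binom (2 * α + 2 + r + 1) (r + 1) = a1 at *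
    generalize binom (2 * α + 2 + r) r = a0 at *
    generalize binom (n + 2 * α + r + 1) (n - 1) = b1 at *
    generalize binom (n + 2 * α + r) (n - 1) = b0 at *
    generalize binom (n + 2 * α + r + 1) (r + 1) = d1 at *
    generalize binom (n + 2 * α + r) r = d0 at *
    linear_combination 2 * (α + 1) * (r + 2 * α + 2) * b1 * h1
      + 2 * (α + 1) * (2 * α + 3 + r) * a0 * h2
      + (2 * α + 3 + r) * (n + 2 * α + r + 1) * ih
      - n * (r + 2 * α + 2) * (r + 2 * α + 3) * scale α n * h3

/-- The Saalschütz value has the binomial `binom(n+2α+r, n)` where `u_r` has `binom(n+2α+r, r)`; the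
weight `binom(2α+2+r, r)` exactly compensates for this. -/
theorem binom_mul_jacobiBinomSum {α : ℝ} (hα : -1 < α) {n : ℕ} (hn : n ≠ 0) (r : ℕ) :
    2 * (α + 1) * binom (2 * α + 2 + r) r * jacobiBinomSum α n r
      = (r + 2 * α + 1) * (r + 2 * α + 2) * scale α n * jacobiCoeff α n r := by
  have h0 : (n : ℝ) ≠ 0 := by exact_mod_cast hn
  have h1 := binom_mul_binom_pred hα hn r
  have h2 := succ_mul_binom_succ (n + 2 * α + r) ((n : ℤ) - 1)
  rw [sub_add_cancel] at h2
  push_cast at h2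
  rw [jacobiBinomSum_eq hα, jacobiCoeff]
  refine mul_left_cancel₀ h0 ?_
  linear_combination 2 * (α + 1) * binom (2 * α + 2 + r) r * binom (n + α) (n - r) * h2
    + (r + 2 * α + 1) * binom (n + α) (n - r) * h1

theorem succ_mul_binom_weight_succ (α : ℝ) (r : ℕ) :
    ((r : ℝ) + 1) * binom (2 * α + 2 + (r + 1 : ℕ)) (r + 1 : ℕ)
      = (r + 2 * α + 3) * binom (2 * α + 2 + r) r := by
  have h1 := succ_mul_binom_add_one (2 * α + 2 + r) r
  push_cast at h1 ⊢
  rw [← add_assoc]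
  linear_combination h1

theorem binom_mul_jacobiBinomSum_succ {α : ℝ} (hα : -1 < α) {n : ℕ} (hn : n ≠ 0) (r : ℕ) :
    2 * (α + 1) * binom (2 * α + 2 + r) r * jacobiBinomSum α n (r + 1)
      = (r + 2 * α + 2) * (r + 1) * scale α n * jacobiCoeff α n (r + 1) := by
  have h1 := binom_mul_jacobiBinomSum hα hn (r + 1)
  have h2 := succ_mul_binom_weight_succ α r
  have hr : (0 : ℝ) ≤ r := r.cast_nonneg
  have hne : (r : ℝ) + 2 * α + 3 ≠ 0 := by linarith
  refine mul_left_cancel₀ hne ?_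
  push_cast at h1 h2 ⊢
  linear_combination (r + 1) * h1 - 2 * (α + 1) * jacobiBinomSum α n (r + 1) * h2

theorem binom_mul_jacobiBinomSum_add_two {α : ℝ} (hα : -1 < α) {n : ℕ} (hn : n ≠ 0) (r : ℕ) :
    2 * (α + 1) * binom (2 * α + 2 + r) r * jacobiBinomSum α n (r + 2)
      = (r + 1) * (r + 2) * scale α n * jacobiCoeff α n (r + 2) := by
  have h1 := binom_mul_jacobiBinomSum_succ hα hn (r + 1)
  have h2 := succ_mul_binom_weight_succ α r
  have hr : (0 : ℝ) ≤ r := r.cast_nonneg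
  have hne : (r : ℝ) + 2 * α + 3 ≠ 0 := by linarith
  refine mul_left_cancel₀ hne ?_
  push_cast at h1 h2 ⊢
  linear_combination (r + 1) * h1 - 2 * (α + 1) * jacobiBinomSum α n (r + 2) * h2

/-- Here `r + 2α + 3` stays on the left: it is what turns the weight at `r` into `r + 1` times the
weight at `r + 1`. -/
theorem binom_mul_jacobiBinomSum_add_three {α : ℝ} (hα : -1 < α) {n : ℕ} (hn : n ≠ 0) (r : ℕ) :
    2 * (α + 1) * binom (2 * α + 2 + r) r * ((r + 2 * α + 3) * jacobiBinomSum α n (r + 3))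
      = (r + 1) * (r + 2) * (r + 3) * scale α n * jacobiCoeff α n (r + 3) := by
  have h1 := binom_mul_jacobiBinomSum_add_two hα hn (r + 1)
  have h2 := succ_mul_binom_weight_succ α r
  push_cast at h1 h2 ⊢
  linear_combination (r + 1) * h1 - 2 * (α + 1) * jacobiBinomSum α n (r + 3) * h2

/-- The coefficient of `σ^r` in `(L + c_0) P = 4B P''`: the sums become multiples of `u_r`,
`u_{r+1}`, `u_{r+2}`, and the recurrence for `u` relates these. -/
theorem jacobi_coeff_identity {α : ℝ} (hα : -1 < α) {n : ℕ} (hn : n ≠ 0) (r : ℕ) :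
    2 * (r * binom (2 * α + 2 + r) r * ∑ m ∈ Finset.range (n + 1),
        jacobiCoeff α n m * ((2 * m - r - 1) * binom (α + 2) ((m : ℤ) - r)))
      = (α + 2) * (4 * (2 * α + 3) * binom (n + 2 * α + 2) ((n : ℤ) - 2) * jacobiCoeff α n r
          - scale α n * ((r + 1) * (r + 2) * jacobiCoeff α n (r + 2))) := by
  have h1 : α + 1 ≠ 0 := by linarith
  rw [sum_jacobiCoeff_mul_weight]
  refine mul_left_cancel₀ h1 ?_
  have c0 := binom_add_two_eq_scale α hn
  have v0 := binom_mul_jacobiBinomSum hα hn r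
  have v1 := binom_mul_jacobiBinomSum_succ hα hn r
  have v2 := binom_mul_jacobiBinomSum_add_two hα hn r
  have r0 := jacobiCoeff_succ α n r
  have r1 := jacobiCoeff_succ α n (r + 1)
  push_cast at r1
  rw [show r + 1 + 1 = r + 2 by ring] at r1
  generalize binom (2 * α + 2 + r) r = w at *
  generalize binom (n + 2 * α + 2) (n - 2) = c at *
  linear_combination r * (r - 1) * v0 + 2 * r * (r + α + 1) * v1 + r * (r + 2 * α + 3) * v2
    - jacobiCoeff α n r * c0 + scale α n * (r + 1) * (r + α + 1) * r1
    + scale α n * ((n - r - 1) * (n + 2 * α + 2 + r) + 2 * r * (r + 2 * α + 2)) * r0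

theorem euler_coeff_identity {α : ℝ} (hα : -1 < α) {n : ℕ} (hn : n ≠ 0) (r : ℕ) :
    2 * (r * binom (2 * α + 2 + r) r * ∑ m ∈ Finset.range (n + 1),
        eulerCoeff α n m * ((2 * m - r - 1) * binom (α + 2) ((m : ℤ) - r)))
      = (α + 2) * (4 * (2 * α + 3) * binom (n + 2 * α + 2) ((n : ℤ) - 2) * eulerCoeff α n r
          - n * (n + 2 * α + 1) * scale α n / (α + 1)
            * ((r + 1) * (r + 2) * jacobiCoeff α n (r + 2) / 2)) := by
  have h1 : α + 1 ≠ 0 := by linarith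
  have hs := sum_eulerCoeff_mul_weight α n r
  have c0 := binom_add_two_eq_scale α hn
  have v0 := binom_mul_jacobiBinomSum hα hn r
  have v1 := binom_mul_jacobiBinomSum_succ hα hn r
  have v2 := binom_mul_jacobiBinomSum_add_two hα hn r
  have v3 := binom_mul_jacobiBinomSum_add_three hα hn r
  have r0 := jacobiCoeff_succ α n r
  have r1 := jacobiCoeff_succ α n (r + 1)
  have r2 := jacobiCoeff_succ α n (r + 2)
  push_cast at r1 r2
  rw [show r + 1 + 1 = r + 2 by ring] at r1
  rw [show r + 2 + 1 = r + 3 by ring] at r2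
  set S := ∑ m ∈ Finset.range (n + 1),
        eulerCoeff α n m * ((2 * m - r - 1) * binom (α + 2) ((m : ℤ) - r))
  rw [eulerCoeff]
  generalize binom (2 * α + 2 + r) r = w at *
  generalize binom (n + 2 * α + 2) (n - 2) = c at *
  generalize jacobiBinomSum α n r = g0 at *
  generalize jacobiBinomSum α n (r + 1) = g1 at *
  generalize jacobiBinomSum α n (r + 2) = g2 at *
  generalize jacobiBinomSum α n (r + 3) = g3 at *
  generalize jacobiCoeff α n r = u0 at *
  generalize jacobiCoeff α n (r + 1) = u1 at *
  generalize jacobiCoeff α n (r + 2) = u2 at *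
  generalize jacobiCoeff α n (r + 3) = u3 at *
  generalize scale α n = B at *
  field_simp
  linear_combination 2 * (α + 1) * r * w * hs
    + r * (2 * r * (r - 1) * v0
      + (2 * (3 * r + 1) * (α + 2) + 4 * r * (r - 1) + r ^ 2 - 1) * v1
      + (4 * (α + 1) * (α + 2) + 2 * (3 * r + 1) * (α + 2) + 2 * r * (r - 1)
            + (3 * r + 3) * (α + 2) + 2 * (r ^ 2 - 1)) * v2
      + (r + α + 3) * v3)
    - ((r + 1) * u1 + 2 * r * u0) * c0
    + B * r * (r + 1) * (r + 2) * r2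
    + B * (r + 1) * (n * (n + 2 * α + 1) + r * (3 * r + 4 * α + 5)) * r1
    + B * (2 * r * (n * (n + 2 * α + 1)) + 2 * r * (r - 1) * (r + 2 * α + 2)) * r0

/-! ### Expansions in powers of `(x - 1) / 2` and Gegenbauer's equation -/

theorem jacobi_eq_sum (α : ℝ) (n : ℕ) :
    jacobi α α n = ∑ m ∈ Finset.range (n + 1),
      C (jacobiCoeff α n m) * (C (1 / 2) * (X - 1)) ^ m := by
  refine Finset.sum_congr rfl fun m _ => ?_
  rw [jacobiCoeff, show (n : ℝ) + α + α + m = n + 2 * α + m by ring]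

theorem X_mul_derivative_half_sub_one_pow (m : ℕ) :
    (X : ℝ[X]) * derivative ((C (1 / 2) * (X - 1)) ^ m)
      = C (m / 2 : ℝ) * (C (1 / 2) * (X - 1)) ^ (m - 1)
        + C (m : ℝ) * (C (1 / 2) * (X - 1)) ^ m := by
  rcases m with _ | m
  · simp
  · have h : (X : ℝ[X]) = 1 + C 2 * (C (1 / 2) * (X - 1)) := by
      rw [← mul_assoc, ← C_mul]; norm_num
    have hd : derivative (C (1 / 2) * (X - 1) : ℝ[X]) = C (1 / 2) := by simp
    rw [derivative_pow_succ, hd, Nat.add_sub_cancel]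
    generalize hs : (C (1 / 2) * (X - 1) : ℝ[X]) = s at *
    rw [h, show (((m + 1 : ℕ) : ℝ) / 2) = (m + 1 : ℝ) * (1 / 2) by push_cast; ring]
    have h2 : (C 2 * C (1 / 2) : ℝ[X]) = 1 := by rw [← C_mul]; norm_num
    push_cast
    simp only [C_mul, C_add, C_1, pow_succ]
    linear_combination (C (m : ℝ) + 1) * s * s ^ m * h2

theorem X_mul_derivative_jacobi (α : ℝ) (n : ℕ) :
    X * derivative (jacobi α α n) = ∑ m ∈ Finset.range (n + 1),
      C (eulerCoeff α n m) * (C (1 / 2) * (X - 1)) ^ m := by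
  have h1 := Finset.sum_range_succ' (fun m : ℕ => C ((m : ℝ) * jacobiCoeff α n m / 2)
      * (C (1 / 2) * (X - 1) : ℝ[X]) ^ (m - 1)) (n + 1)
  rw [Finset.sum_range_succ, jacobiCoeff_eq_zero α (Nat.lt_succ_self n)] at h1
  simp only [Nat.cast_zero, zero_mul, mul_zero, zero_div, C_0, add_zero,
    Nat.add_sub_cancel] at h1
  rw [jacobi_eq_sum, derivative_sum, Finset.mul_sum]
  have h2 : ∀ m ∈ Finset.range (n + 1), (X : ℝ[X]) * derivative (C (jacobiCoeff α n m)
        * (C (1 / 2) * (X - 1)) ^ m)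
      = C ((m : ℝ) * jacobiCoeff α n m / 2) * (C (1 / 2) * (X - 1) : ℝ[X]) ^ (m - 1)
        + C ((m : ℝ) * jacobiCoeff α n m) * (C (1 / 2) * (X - 1) : ℝ[X]) ^ m := by
    intro m _
    rw [derivative_C_mul, mul_left_comm, X_mul_derivative_half_sub_one_pow,
      show (m : ℝ) * jacobiCoeff α n m / 2 = jacobiCoeff α n m * (m / 2) by ring, C_mul, C_mul]
    ring
  rw [Finset.sum_congr rfl h2, Finset.sum_add_distrib, h1, ← Finset.sum_add_distrib]
  refine Finset.sum_congr rfl fun m _ => ?_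
  rw [← add_mul, ← C_add, eulerCoeff]
  congr 2
  push_cast
  ring

theorem eval_iterate_derivative_sum (a : ℕ → ℝ) (n i : ℕ) (x : ℝ) :
    (derivative^[i] (∑ m ∈ Finset.range n,
        C (a m) * (C (1 / 2) * (X - 1) : ℝ[X]) ^ m)).eval x
      = ∑ m ∈ Finset.range n,
        a m * (derivative^[i] ((C (1 / 2) * (X - 1) : ℝ[X]) ^ m)).eval x := by
  rw [iterate_derivative_sum, eval_finsetSum]
  simp only [iterate_derivative_C_mul, eval_mul, eval_C]

theorem eval_iterate_derivative_sum_eq_zero (a : ℕ → ℝ) {n i : ℕ} (h : n ≤ i) (x : ℝ) :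
    (derivative^[i] (∑ m ∈ Finset.range n,
        C (a m) * (C (1 / 2) * (X - 1) : ℝ[X]) ^ m)).eval x = 0 := by
  rw [eval_iterate_derivative_sum]
  refine Finset.sum_eq_zero fun m hm => ?_
  rw [Finset.mem_range] at hm
  rw [eval_iterate_derivative_half_sub_one_pow, Nat.descFactorial_of_lt (by omega)]
  simp

theorem eval_sum_half_sub_one_pow (a : ℕ → ℝ) (n : ℕ) (x : ℝ) :
    (∑ m ∈ Finset.range n, C (a m) * (C (1 / 2) * (X - 1) : ℝ[X]) ^ m).eval x
      = ∑ m ∈ Finset.range n, a m * ((x - 1) / 2) ^ m := by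
  rw [eval_finsetSum]
  refine Finset.sum_congr rfl fun m _ => ?_
  simp only [eval_mul, eval_C, eval_pow, eval_sub, eval_X, eval_one]
  ring

theorem eval_derivative_two_jacobi (α : ℝ) (n : ℕ) (x : ℝ) :
    (derivative^[2] (jacobi α α n)).eval x = ∑ r ∈ Finset.range (n + 2),
      (r + 1) * (r + 2) * jacobiCoeff α n (r + 2) / 4 * ((x - 1) / 2) ^ r := by
  have h := Finset.sum_subset (Finset.range_mono (show n + 1 ≤ n + 2 + 1 + 1 by omega))
    (f := fun m => jacobiCoeff α n m
      * (derivative^[2] ((C (1 / 2) * (X - 1) : ℝ[X]) ^ m)).eval x)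
    (fun m _ hm => by
      rw [Finset.mem_range] at hm
      rw [jacobiCoeff_eq_zero α (by omega), zero_mul])
  rw [jacobi_eq_sum, eval_iterate_derivative_sum, h, Finset.sum_range_succ',
    Finset.sum_range_succ']
  simp only [eval_iterate_derivative_half_sub_one_pow]
  norm_num [Nat.descFactorial]
  refine Finset.sum_congr rfl fun r _ => ?_
  rw [show r + 1 + 1 - 2 = r by omega]
  ring

/-- Gegenbauer's differential equation. -/
theorem jacobi_ode (α : ℝ) (n : ℕ) :
    (1 - X ^ 2) * derivative (derivative (jacobi α α n))
      - C (2 * (α + 1)) * (X * derivative (jacobi α α n))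
      + C (n * (n + 2 * α + 1)) * jacobi α α n = 0 := by
  refine Polynomial.funext fun x => ?_
  -- With `F(m) = m(m + α) u_m σ^(m-1)`, the operator maps `u_m σ^m` to `F(m+1) - F(m)`, by the
  -- recurrence for `u`.
  have tele := Finset.sum_range_sub
    (fun m : ℕ => (m : ℝ) * (m + α) * jacobiCoeff α n m * ((x - 1) / 2) ^ (m - 1)) (n + 1)
  rw [jacobiCoeff_eq_zero α (Nat.lt_succ_self n)] at tele
  simp only [Nat.cast_zero, zero_mul, mul_zero, sub_zero] at tele
  have hd : ∀ i, (derivative^[i] (jacobi α α n)).eval x = _ := fun i => by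
    rw [jacobi_eq_sum, eval_iterate_derivative_sum]
  have h0 := hd 0
  have h1 := hd 1
  have h2 := hd 2
  simp only [Function.iterate_succ, Function.iterate_zero, Function.comp_apply, id] at h0 h1 h2
  simp only [eval_add, eval_sub, eval_mul, eval_C, eval_one, eval_X, eval_pow, eval_zero]
  rw [h0, h1, h2, ← tele]
  simp only [Finset.mul_sum, ← Finset.sum_sub_distrib, ← Finset.sum_add_distrib]
  refine Finset.sum_congr rfl fun m _ => ?_
  have e0 := eval_iterate_derivative_half_sub_one_pow m 0 x
  have e1 := eval_iterate_derivative_half_sub_one_pow m 1 x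
  have e2 := eval_iterate_derivative_half_sub_one_pow m 2 x
  simp only [Function.iterate_succ, Function.iterate_zero, Function.comp_apply, id] at e0 e1 e2
  rw [e0, e1, e2]
  have hu := jacobiCoeff_succ α n m
  rcases m with _ | _ | m
  · simp at hu ⊢
    linear_combination -hu
  · norm_num [Nat.descFactorial] at hu ⊢
    linear_combination -((x - 1) / 2) * hu
  · rw [show m + 1 + 1 - 2 = m by omega, show m + 1 + 1 - 1 = m + 1 by omega]
    simp only [Nat.descFactorial, Nat.add_sub_cancel, Nat.sub_zero, pow_succ, pow_zero]
    push_cast at hu ⊢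
    linear_combination -((x - 1) / 2) ^ m * ((x - 1) / 2) * ((x - 1) / 2) * hu

/-- The Euler operator `x D` commutes with every part of the equation except `D²`, and its
commutator with `D²` is `-2D²`. -/
theorem euler_ode {P : ℝ[X]} {a l : ℝ}
    (h : (1 - X ^ 2) * derivative (derivative P) - C a * (X * derivative P) + C l * P = 0) :
    (1 - X ^ 2) * derivative (derivative (X * derivative P))
      - C a * (X * derivative (X * derivative P)) + C l * (X * derivative P)
      = 2 * derivative (derivative P) := by
  have hd := congrArg derivative h
  simp only [derivative_add, derivative_sub, derivative_mul, derivative_X, derivative_C,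
    derivative_one, derivative_X_pow, derivative_zero] at hd ⊢
  norm_num at hd
  rw [show (C 2 : ℝ[X]) = 2 from map_ofNat C 2] at hd
  linear_combination X * hd

/-! ### The operator on `P` and on `xP'` -/

theorem sum_cPos_mul_derivative_sum {α : ℝ} (hα : -1 < α) (a : ℕ → ℝ) (x : ℝ) {n N : ℕ}
    (hN : n < N) :
    ∑ i ∈ Finset.range N, cPos α i x * (derivative^[i] (∑ m ∈ Finset.range (n + 1),
        C (a m) * (C (1 / 2) * (X - 1) : ℝ[X]) ^ m)).eval x
      = -(2 / (α + 2)) * ∑ r ∈ Finset.range (n + 2),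
        r * binom (2 * α + 2 + r) r * (∑ m ∈ Finset.range (n + 1),
          a m * ((2 * m - r - 1) * binom (α + 2) ((m : ℤ) - r))) * ((x - 1) / 2) ^ r := by
  have h : ∀ m ∈ Finset.range (n + 1), a m * ∑ i ∈ Finset.range N,
      cPos α i x * (derivative^[i] ((C (1 / 2) * (X - 1) : ℝ[X]) ^ m)).eval x
      = a m * _ := fun m hm => by
    rw [sum_cPos_mul_derivative_pow hα x m N (n + 1)
      (by have := Finset.mem_range.mp hm; omega) (Finset.mem_range.mp hm)]
  have h' := Finset.sum_congr rfl h
  simp only [eval_iterate_derivative_sum]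
  calc _ = ∑ m ∈ Finset.range (n + 1), a m * ∑ i ∈ Finset.range N,
      cPos α i x * (derivative^[i] ((C (1 / 2) * (X - 1) : ℝ[X]) ^ m)).eval x := by
        simp only [Finset.mul_sum]
        rw [Finset.sum_comm]
        exact Finset.sum_congr rfl fun _ _ => Finset.sum_congr rfl fun _ _ => by ring
    _ = _ := by
        rw [h']
        simp only [Finset.mul_sum, Finset.sum_mul]
        rw [Finset.sum_comm]
        exact Finset.sum_congr rfl fun _ _ => Finset.sum_congr rfl fun _ _ => by ring

theorem sum_range_succ_of_eq_zero (f : ℕ → ℝ) {n : ℕ} (h : f (n + 1) = 0) :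
    ∑ m ∈ Finset.range (n + 1), f m = ∑ m ∈ Finset.range (n + 2), f m := by
  rw [Finset.sum_range_succ _ (n + 1), h, add_zero]

theorem sum_cPos_jacobi {α : ℝ} (hα : -1 < α) {n N : ℕ} (hn : n ≠ 0) (hN : n < N) (x : ℝ) :
    ∑ i ∈ Finset.range N, cPos α i x * (derivative^[i] (jacobi α α n)).eval x
      + 4 * (2 * α + 3) * binom (n + 2 * α + 2) ((n : ℤ) - 2) * (jacobi α α n).eval x
      = 4 * scale α n * (derivative^[2] (jacobi α α n)).eval x := by
  have h2 : α + 2 ≠ 0 := by linarith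
  have hs := sum_range_succ_of_eq_zero (fun m => jacobiCoeff α n m * ((x - 1) / 2) ^ m)
    (by rw [jacobiCoeff_eq_zero α (Nat.lt_succ_self n), zero_mul])
  rw [eval_derivative_two_jacobi, jacobi_eq_sum, sum_cPos_mul_derivative_sum hα _ _ hN,
    eval_sum_half_sub_one_pow, hs, Finset.mul_sum,
    Finset.mul_sum, Finset.mul_sum, ← Finset.sum_add_distrib]
  refine Finset.sum_congr rfl fun r _ => ?_
  have h := jacobi_coeff_identity hα hn r
  generalize (∑ m ∈ Finset.range (n + 1),
    jacobiCoeff α n m * ((2 * m - r - 1) * binom (α + 2) ((m : ℤ) - r))) = S at *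
  generalize binom (2 * α + 2 + r) r = w at *
  generalize binom (n + 2 * α + 2) (n - 2) = c at *
  generalize ((x - 1) / 2) ^ r = s at *
  field_simp
  linear_combination -s * h

theorem sum_cPos_X_mul_derivative_jacobi {α : ℝ} (hα : -1 < α) {n N : ℕ} (hn : n ≠ 0)
    (hN : n < N) (x : ℝ) :
    ∑ i ∈ Finset.range N, cPos α i x * (derivative^[i] (X * derivative (jacobi α α n))).eval x
      + 4 * (2 * α + 3) * binom (n + 2 * α + 2) ((n : ℤ) - 2)
        * (X * derivative (jacobi α α n)).eval x
      = 2 * (n * (n + 2 * α + 1) * scale α n / (α + 1))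
        * (derivative^[2] (jacobi α α n)).eval x := by
  have h1 : α + 1 ≠ 0 := by linarith
  have h2 : α + 2 ≠ 0 := by linarith
  have hs := sum_range_succ_of_eq_zero (n := n) (fun m => eulerCoeff α n m * ((x - 1) / 2) ^ m)
    (by
      rw [eulerCoeff, jacobiCoeff_eq_zero α (Nat.lt_succ_self n),
        jacobiCoeff_eq_zero α (show n < n + 1 + 1 by omega)]
      ring)
  rw [eval_derivative_two_jacobi, X_mul_derivative_jacobi, sum_cPos_mul_derivative_sum hα _ _ hN,
    eval_sum_half_sub_one_pow, hs, Finset.mul_sum,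
    Finset.mul_sum, Finset.mul_sum, ← Finset.sum_add_distrib]
  refine Finset.sum_congr rfl fun r _ => ?_
  have h := euler_coeff_identity hα hn r
  generalize (∑ m ∈ Finset.range (n + 1),
    eulerCoeff α n m * ((2 * m - r - 1) * binom (α + 2) ((m : ℤ) - r))) = S at *
  generalize binom (2 * α + 2 + r) r = w at *
  generalize binom (n + 2 * α + 2) (n - 2) = c at *
  generalize ((x - 1) / 2) ^ r = s at *
  generalize eulerCoeff α n r = v at *
  field_simp at h ⊢
  linear_combination -2 * s * h

/-! ### The constants `C₀`, `C₁` and the differential equation -/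

theorem C₀_eq {α : ℝ} (hα : -1 < α) (M : ℝ) {n : ℕ} (hn : n ≠ 0) :
    C₀ α M n = (1 + M * (n * (n + 2 * α + 1) * scale α n / (α + 1))) ^ 2 := by
  have h1 : α + 1 ≠ 0 := by linarith
  have h := binom_add_one_pred_eq_scale α hn
  have h' : binom (n + 2 * α + 1) ((n : ℤ) - 1)
      = n * (n + 2 * α + 1) * scale α n / (2 * (α + 1)) := by
    rw [← h]; field_simp
  rw [C₀, binom_add_one_eq_scale α hn, h']
  field_simp
  ring

theorem C₁_eq {α : ℝ} (hα : -1 < α) (M : ℝ) {n : ℕ} (hn : n ≠ 0) :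
    C₁ α M n = 2 * M * scale α n
      * (1 + M * (n * (n + 2 * α + 1) * scale α n / (α + 1))) := by
  have h0 : (n : ℝ) ≠ 0 := by exact_mod_cast hn
  have h1 : α + 1 ≠ 0 := by linarith
  have key : (if 2 * α + 1 = 0 then 2 * M / n
      else 2 * M / (2 * α + 1) * binom (n + 2 * α) n) = 2 * M * scale α n := by
    split_ifs with h
    -- At `α = -1/2` the normalising factor is `binom(n-1, n-1) / n = 1 / n`, in agreement with the
    -- limit value `2M / n`.
    · have e : (n : ℝ) + 2 * α = ((n - 1 : ℕ) : ℝ) := by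
        rw [Nat.cast_sub (by omega)]; push_cast; linarith
      have e' : (n : ℤ) - 1 = ((n - 1 : ℕ) : ℤ) := by omega
      rw [scale, e, e', binom_natCast, Ring.choose_natCast, Nat.choose_self]
      push_cast
      ring
    · rw [binom_eq_scale α hn]
      field_simp
  rw [C₁, key, binom_add_one_eq_scale α hn, ← natCast_mul_scale α hn]
  field_simp

theorem cPos_zero (α x : ℝ) : cPos α 0 x = 0 := by
  simp [cPos, cStar]

theorem sum_coeffDE {α : ℝ} (n N : ℕ) (hN : 0 < N) (x : ℝ) (f : ℕ → ℝ) :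
    ∑ i ∈ Finset.range N, coeffDE α n i x * f i
      = ∑ i ∈ Finset.range N, cPos α i x * f i
        + 4 * (2 * α + 3) * binom (n + 2 * α + 2) ((n : ℤ) - 2) * f 0 := by
  obtain ⟨k, rfl⟩ : ∃ k, N = k + 1 := ⟨N - 1, by omega⟩
  rw [Finset.sum_range_succ', Finset.sum_range_succ']
  simp [coeffDE, cPos_zero]

theorem genJacobi_eq_sum (α M : ℝ) (n : ℕ) :
    genJacobi α M n = ∑ m ∈ Finset.range (n + 1),
      C (C₀ α M n * jacobiCoeff α n m - C₁ α M n * eulerCoeff α n m)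
        * (C (1 / 2) * (X - 1)) ^ m := by
  rw [genJacobi, mul_assoc, X_mul_derivative_jacobi, jacobi_eq_sum, Finset.mul_sum,
    Finset.mul_sum, ← Finset.sum_sub_distrib]
  refine Finset.sum_congr rfl fun m _ => ?_
  rw [C_sub, C_mul, C_mul]
  ring

theorem genJacobi_zero (α M : ℝ) : genJacobi α M 0 = 1 := by
  simp [genJacobi, jacobi, C₀, binom_zero, binom_of_neg]

theorem genJacobi_ode {α : ℝ} (hα : -1 < α) (M : ℝ) (n : ℕ) (x : ℝ) :
    M * (∑ i ∈ Finset.range (n + 1),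
        coeffDE α n i x * (derivative^[i] (genJacobi α M n)).eval x)
      + (1 - x ^ 2) * (derivative^[2] (genJacobi α M n)).eval x
      - 2 * (α + 1) * x * (derivative (genJacobi α M n)).eval x
      + n * (n + 2 * α + 1) * (genJacobi α M n).eval x = 0 := by
  -- For `n = 0`, where `scale` would divide by zero, `y = 1` and `c_0 = 0`.
  rcases eq_or_ne n 0 with rfl | hn
  · simp [genJacobi_zero, coeffDE, binom_of_neg]
  rw [sum_coeffDE _ _ n.succ_pos]
  have hP := sum_cPos_jacobi hα hn n.lt_succ_self x
  have hQ := sum_cPos_X_mul_derivative_jacobi hα hn n.lt_succ_self x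
  have oP := jacobi_ode α n
  have oQ := congrArg (eval x) (euler_ode oP)
  replace oP := congrArg (eval x) oP
  set P := jacobi α α n
  have hy : genJacobi α M n = C (C₀ α M n) * P - C (C₁ α M n) * (X * derivative P) := by
    rw [genJacobi, mul_assoc]
  have hD : ∀ i, (derivative^[i] (genJacobi α M n)).eval x
      = C₀ α M n * (derivative^[i] P).eval x
        - C₁ α M n * (derivative^[i] (X * derivative P)).eval x := fun i => by
    rw [hy, iterate_derivative_sub, iterate_derivative_C_mul, iterate_derivative_C_mul]
    simp only [eval_sub, eval_mul, eval_C]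
  have d0 := hD 0
  have d1 := hD 1
  have d2 := hD 2
  simp only [hD]
  have hS : ∑ i ∈ Finset.range (n + 1), cPos α i x * (C₀ α M n * (derivative^[i] P).eval x
        - C₁ α M n * (derivative^[i] (X * derivative P)).eval x)
      = C₀ α M n * ∑ i ∈ Finset.range (n + 1), cPos α i x * (derivative^[i] P).eval x
        - C₁ α M n * ∑ i ∈ Finset.range (n + 1),
          cPos α i x * (derivative^[i] (X * derivative P)).eval x := by
    rw [Finset.mul_sum, Finset.mul_sum, ← Finset.sum_sub_distrib]
    exact Finset.sum_congr rfl fun _ _ => by ring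
  rw [hS]
  generalize ∑ i ∈ Finset.range (n + 1), cPos α i x * (derivative^[i] P).eval x = S1 at *
  generalize ∑ i ∈ Finset.range (n + 1),
    cPos α i x * (derivative^[i] (X * derivative P)).eval x = S2 at *
  generalize hR : X * derivative P = R at *
  simp only [Function.iterate_succ, Function.iterate_zero, Function.comp_apply, id, eval_add,
    eval_sub, eval_mul, eval_C, eval_one, eval_X, eval_pow, eval_zero, eval_ofNat]
    at d0 d1 d2 hP hQ oP oQ ⊢
  have hR' : x * eval x (derivative P) = eval x R := by rw [← hR, eval_mul, eval_X]
  rw [d0, d1]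
  have c0 := C₀_eq hα M hn
  have c1 := C₁_eq hα M hn
  generalize n * (n + 2 * α + 1) * scale α n / (α + 1) = c at *
  generalize scale α n = B at *
  rw [c0, c1]
  rw [← hR] at oP
  simp only [eval_mul, eval_X] at oP
  generalize binom (n + 2 * α + 2) (n - 2) = k at *
  linear_combination M * ((1 + M * c) ^ 2) * hP - M * (2 * M * B * (1 + M * c)) * hQ
    + (1 + M * c) ^ 2 * oP - 2 * M * B * (1 + M * c) * oQ

/-! ### Finite order for integer `α` -/

theorem iteratedDeriv_eval (p : ℝ[X]) (i : ℕ) (x : ℝ) :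
    iteratedDeriv i (fun t => p.eval t) x = (derivative^[i] p).eval x := by
  induction i generalizing x with
  | zero => simp
  | succ i ih =>
    rw [iteratedDeriv_succ, funext ih, Function.iterate_succ_apply']
    exact Polynomial.deriv _

/-- Both upper entries are natural numbers. A nonzero term needs `k ≤ i - 2a - 5`, but then `i - k -
2 ≥ 2a + 3 > a + 1`. -/
theorem cPos_natCast_eq_zero (a : ℕ) {i : ℕ} (hi : 2 * a + 4 < i) (x : ℝ) :
    cPos a i x = 0 := by
  have h : cStar a i x = 0 := by
    rw [cStar, Finset.sum_eq_zero, mul_zero]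
    intro k _
    have e1 : (i : ℝ) - 2 * a - 5 = ((i - 2 * a - 5 : ℕ) : ℝ) := by
      rw [Nat.cast_sub (by omega), Nat.cast_sub (by omega)]; push_cast; ring
    rcases le_or_gt k (i - 2 * a - 5) with hk | hk
    · have e2 : (i : ℤ) - k - 2 = ((i - k - 2 : ℕ) : ℤ) := by omega
      have e3 : (a : ℝ) + 1 = ((a + 1 : ℕ) : ℝ) := by push_cast; ring
      rw [e2, e3, binom_natCast (a + 1 : ℕ), Ring.choose_natCast,
        Nat.choose_eq_zero_of_lt (by omega)]
      simp
    · rw [e1, binom_natCast (i - 2 * a - 5 : ℕ), Ring.choose_natCast,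
        Nat.choose_eq_zero_of_lt hk]
      simp
  rw [cPos, h, mul_zero]

theorem binom_neg_one (k : ℕ) : binom (-1) k = (-1) ^ k := by
  induction k with
  | zero => simp [binom_zero]
  | succ k ih =>
    have h := succ_mul_binom_succ (-1) k
    have hk : (k : ℝ) + 1 ≠ 0 := by positivity
    refine mul_left_cancel₀ hk ?_
    push_cast at h ⊢
    rw [h, ih]
    ring

/-- For `i = 2a + 4` the second upper entry is `-1`, so that binomial is `(-1)^k`. At `x = 3` also
`(1 - x) / 2 = -1`: the signs cancel, all terms are nonnegative, and `k = 2a + 2` contributes `1`.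
-/
theorem cPos_natCast_three_ne_zero (a : ℕ) : cPos a (2 * a + 4) 3 ≠ 0 := by
  have hterm : ∀ k ∈ Finset.range (2 * a + 4 - 1),
      binom ((a : ℝ) + 1) (((2 * a + 4 : ℕ) : ℤ) - k - 2)
        * binom ((2 * a + 4 : ℕ) - 2 * a - 5) k * ((1 - 3) / 2) ^ k
      = ((a + 1).choose (2 * a + 2 - k) : ℝ) := by
    intro k hk
    have hk' := Finset.mem_range.mp hk
    have e2 : ((2 * a + 4 : ℕ) : ℤ) - k - 2 = ((2 * a + 2 - k : ℕ) : ℤ) := by omega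
    have e3 : (a : ℝ) + 1 = ((a + 1 : ℕ) : ℝ) := by push_cast; ring
    have e4 : ((2 * a + 4 : ℕ) : ℝ) - 2 * a - 5 = -1 := by push_cast; ring
    rw [e2, e3, e4, binom_natCast (a + 1 : ℕ), Ring.choose_natCast, binom_neg_one,
      show (1 - 3) / 2 = (-1 : ℝ) by norm_num, mul_assoc, ← mul_pow]
    norm_num
  have hpos : 0 < ∑ k ∈ Finset.range (2 * a + 4 - 1),
      ((a + 1).choose (2 * a + 2 - k) : ℝ) := by
    refine Finset.sum_pos' (fun _ _ => Nat.cast_nonneg _)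
      ⟨2 * a + 2, Finset.mem_range.mpr (by omega), ?_⟩
    simp
  rw [cPos, cStar, Finset.sum_congr rfl hterm]
  refine mul_ne_zero (mul_ne_zero (by positivity) (by norm_num)) (mul_ne_zero ?_ hpos.ne')
  positivity

end SymJacobi

theorem theorem5 (α M : ℝ) (hα : -1 < α) (hM : 0 ≤ M) :
    (∀ (n : ℕ) (y : ℝ → ℝ), (y = fun t => (SymJacobi.genJacobi α M n).eval t) →
      ∀ x : ℝ,
        Summable (fun i : ℕ => SymJacobi.coeffDE α n i x * iteratedDeriv i y x) ∧
        M * (∑' i : ℕ, SymJacobi.coeffDE α n i x * iteratedDeriv i y x)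
          + (1 - x ^ 2) * iteratedDeriv 2 y x - 2 * (α + 1) * x * deriv y x
          + n * (n + 2 * α + 1) * y x = 0) ∧
    (∀ a : ℕ, α = a →
      (∀ i : ℕ, 2 * a + 4 < i → ∀ x : ℝ, SymJacobi.cPos α i x = 0) ∧
      (∃ x : ℝ, SymJacobi.cPos α (2 * a + 4) x ≠ 0) ∧
      (∀ (n : ℕ) (y : ℝ → ℝ), (y = fun t => (SymJacobi.genJacobi α M n).eval t) →
        ∀ x : ℝ,
          M * (∑ i ∈ Finset.range (2 * a + 5),
              SymJacobi.coeffDE α n i x * iteratedDeriv i y x)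
            + (1 - x ^ 2) * iteratedDeriv 2 y x - 2 * (α + 1) * x * deriv y x
            + n * (n + 2 * α + 1) * y x = 0)) := by
  have main : ∀ (n : ℕ) (y : ℝ → ℝ), (y = fun t => (SymJacobi.genJacobi α M n).eval t) →
      ∀ x : ℝ,
        Summable (fun i : ℕ => SymJacobi.coeffDE α n i x * iteratedDeriv i y x) ∧
        M * (∑' i : ℕ, SymJacobi.coeffDE α n i x * iteratedDeriv i y x)
          + (1 - x ^ 2) * iteratedDeriv 2 y x - 2 * (α + 1) * x * deriv y x
          + n * (n + 2 * α + 1) * y x = 0 := by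
    rintro n y rfl x
    -- `y` is a polynomial of degree at most `n`, so the series is a finite sum.
    have h0 : ∀ i ∉ Finset.range (n + 1), SymJacobi.coeffDE α n i x
        * iteratedDeriv i (fun t => (SymJacobi.genJacobi α M n).eval t) x = 0 := by
      intro i hi
      rw [Finset.mem_range, not_lt] at hi
      rw [SymJacobi.iteratedDeriv_eval, SymJacobi.genJacobi_eq_sum,
        SymJacobi.eval_iterate_derivative_sum_eq_zero _ hi, mul_zero]
    refine ⟨summable_of_ne_finset_zero h0, ?_⟩
    rw [tsum_eq_sum h0]
    simp only [SymJacobi.iteratedDeriv_eval, Polynomial.deriv]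
    exact SymJacobi.genJacobi_ode hα M n x
  refine ⟨main, ?_⟩
  rintro a rfl
  refine ⟨fun i hi x => SymJacobi.cPos_natCast_eq_zero a hi x,
    ⟨3, SymJacobi.cPos_natCast_three_ne_zero a⟩, fun n y hy x => ?_⟩
  have h0 : ∀ i ∉ Finset.range (2 * a + 5),
      SymJacobi.coeffDE (a : ℝ) n i x * iteratedDeriv i y x = 0 := by
    intro i hi
    rw [Finset.mem_range, not_lt] at hi
    rw [SymJacobi.coeffDE, if_neg (by omega),
      SymJacobi.cPos_natCast_eq_zero a (show 2 * a + 4 < i by omega), zero_mul]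
  have hs : ∑' i, SymJacobi.coeffDE (a : ℝ) n i x * iteratedDeriv i y x = _ := tsum_eq_sum h0
  rw [← hs]
  exact (main n y hy x).2
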